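/- Let $M,N,L\ge 0$ be integers, let $\boldsymbol\phi:\mathbb R^M\to\mathbb R^N$ and $h:\mathbb R^M\to[0,\infty)$ be measurable, with $h$ not equal to $0$ almost everywhere, and let $$\mathcal N=\Big\{\mathbf x\in\mathbb R^N : \int_{\mathbb R^M}\exp\big(\boldsymbol\phi^T(\mathbf y)\mathbf x\big)h(\mathbf y)\,d\mathbf y<\infty\Big\}$$ be the natural parameter space. For $\mathbf x\in\mathcal N$ let $A(\mathbf x)=\log\int_{\mathbb R^M}\exp(\boldsymbol\phi^T(\mathbf y)\mathbf x)h(\mathbf y)\,d\mathbf y$ and let $\mathsf E_{\mathbf x}$ denote expectation when $\mathbf y$ has the probability density $f(\mathbf y;\mathbf x)=\exp(\boldsymbol\phi^T(\mathbf y)\mathbf x-A(\mathbf x))\,h(\mathbf y)$ with respect to Lebesgue measure on $\mathbb R^M$ (the canonical exponential family with sufficient statistic $\boldsymbol\phi$ and weight function $h$). For multi-indices $\mathbf p,\mathbf q\in\mathbb Z_+^N$ write $\boldsymbol\phi^{\mathbf p}(\mathbf y)=\prod_{k=1}^N\phi_k(\mathbf y)^{p_k}$, $\binom{\mathbf q}{\mathbf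 p}=\prod_{k=1}^N\binom{q_k}{p_k}$, $\partial^{\mathbf p}=\frac{\partial^{p_1}}{\partial x_1^{p_1}}\cdots\frac{\partial^{p_N}}{\partial x_N^{p_N}}$, and $\mathbf p\le\mathbf q$ if $p_k\le q_k$ for all $k$. Let $\mathcal X\subseteq\mathcal N$ be a parameter set and $\mathbf x_0$ an interior point of $\mathcal X$ such that $\mathbf x_1+\mathbf x_2-\mathbf x_0\in\mathcal N$ for all $\mathbf x_1,\mathbf x_2\in\mathcal X$. Let $\mathbf p_1,\dots,\mathbf p_L\in\mathbb Z_+^N$ be multi-indices, and let $\hat g:\mathbb R^M\to\mathbb R$ be a measurable function (an estimator) whose variance $v(\hat g;\mathbf x_0)=\mathsf E_{\mathbf x_0}\{(\hat g(\mathbf y)-\mathsf E_{\mathbf x_0}\{\hat g(\mathbf y)\})^2\}$ at $\mathbf x_0$ is finite. Then the mean function $\gamma(\mathbf x)=\mathsf E_{\mathbf x}\{\hat g(\mathbf y)\}$ exists for every $\mathbf x\in\mathcal X$ (that is, $\mathsf E_{\mathbf x}\{|\hat g(\mathbf y)|\}<\infty$), it is infinitely differentiable on the interior of $\mathcal X$,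 all moments $\mathsf E_{\mathbf x_0}\{\boldsymbol\phi^{\mathbf p}(\mathbf y)\}$, $\mathbf p\in\mathbb Z_+^N$, exist (as absolutely convergent integrals), and $$v(\hat g;\mathbf x_0)\;\ge\;\mathbf n^T(\mathbf x_0)\,\mathbf S^\dagger(\mathbf x_0)\,\mathbf n(\mathbf x_0)-\gamma^2(\mathbf x_0),$$ where $\mathbf S^\dagger$ is the Moore--Penrose pseudoinverse of $\mathbf S$, and the vector $\mathbf n(\mathbf x_0)\in\mathbb R^L$ and the matrix $\mathbf S(\mathbf x_0)\in\mathbb R^{L\times L}$ have the entries $$\big(\mathbf n(\mathbf x_0)\big)_l=\sum_{\mathbf p\le\mathbf p_l}\binom{\mathbf p_l}{\mathbf p}\,\mathsf E_{\mathbf x_0}\big\{\boldsymbol\phi^{\mathbf p_l-\mathbf p}(\mathbf y)\big\}\,\partial^{\mathbf p}\gamma(\mathbf x_0),\qquad \big(\mathbf S(\mathbf x_0)\big)_{l,l'}=\mathsf E_{\mathbf x_0}\big\{\boldsymbol\phi^{\mathbf p_l+\mathbf p_{l'}}(\mathbf y)\big\}.$$ -/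

import Mathlib

open MeasureTheory ProbabilityTheory Matrix
open scoped ContDiff

/-! ### The Moore-Penrose pseudoinverse of a real matrix -/

/-- The four Penrose equations: `B` is a Moore-Penrose pseudoinverse of `A`. -/
structure IsMoorePenrose {m n : Type*} [Fintype m] [Fintype n]
    (A : Matrix m n ℝ) (B : Matrix n m ℝ) : Prop where
  mul_mul_left : A * B * A = A
  mul_mul_right : B * A * B = B
  symm_left : (A * B)ᵀ = A * B
  symm_right : (B * A)ᵀ = B * A

theorem IsMoorePenrose.unique {m n : Type*} [Fintype m] [Fintype n]
    {A : Matrix m n ℝ} {B C : Matrix n m ℝ}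
    (hB : IsMoorePenrose A B) (hC : IsMoorePenrose A C) : B = C := by
  have h1 : A * B = A * C := by
    calc A * B = (A * C * A) * B := by rw [hC.mul_mul_left]
      _ = (A * C)ᵀ * (A * B)ᵀ := by rw [hC.symm_left, hB.symm_left, Matrix.mul_assoc]
      _ = ((A * B * A) * C)ᵀ := by rw [← Matrix.transpose_mul, ← Matrix.mul_assoc]
      _ = A * C := by rw [hB.mul_mul_left, hC.symm_left]
  have h2 : B * A = C * A := by
    calc B * A = B * (A * C * A) := by rw [hC.mul_mul_left]
      _ = (B * A)ᵀ * (C * A)ᵀ := by rw [hB.symm_right, hC.symm_right]; simp only [Matrix.mul_assoc]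
      _ = (C * (A * B * A))ᵀ := by rw [← Matrix.transpose_mul]; simp only [Matrix.mul_assoc]
      _ = C * A := by rw [hB.mul_mul_left, hC.symm_right]
  calc B = B * A * B := hB.mul_mul_right.symm
    _ = C * (A * B) := by rw [h2, Matrix.mul_assoc]
    _ = C * A * C := by rw [h1, Matrix.mul_assoc]
    _ = C := hC.mul_mul_right

theorem IsMoorePenrose.exists_of_isSymm {n : Type*} [Fintype n] [DecidableEq n]
    (A : Matrix n n ℝ) (hA : Aᵀ = A) : ∃ B, IsMoorePenrose A B ∧ Bᵀ = B := by
  have hH : A.IsHermitian := by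
    rw [Matrix.IsHermitian, Matrix.conjTranspose_eq_transpose_of_trivial, hA]
  obtain ⟨U, d, hU, hAU⟩ : ∃ (U : Matrix n n ℝ) (d : n → ℝ),
      Uᵀ * U = 1 ∧ A = U * diagonal d * Uᵀ := by
    refine ⟨hH.eigenvectorUnitary, hH.eigenvalues, ?_, ?_⟩
    · have := Unitary.coe_star_mul_self hH.eigenvectorUnitary
      rwa [Matrix.star_eq_conjTranspose, Matrix.conjTranspose_eq_transpose_of_trivial] at this
    · have := hH.spectral_theorem
      rw [Unitary.conjStarAlgAut_apply, Matrix.star_eq_conjTranspose,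
        Matrix.conjTranspose_eq_transpose_of_trivial] at this
      exact this
  have key : ∀ a b : n → ℝ, (U * diagonal a * Uᵀ) * (U * diagonal b * Uᵀ)
      = U * diagonal (fun i => a i * b i) * Uᵀ := by
    intro a b
    calc _ = U * diagonal a * (Uᵀ * U) * diagonal b * Uᵀ := by simp only [Matrix.mul_assoc]
      _ = _ := by
        rw [hU, Matrix.mul_one, Matrix.mul_assoc U, Matrix.diagonal_mul_diagonal]
  have symm : ∀ a : n → ℝ, (U * diagonal a * Uᵀ)ᵀ = U * diagonal a * Uᵀ := by
    intro a
    simp [Matrix.transpose_mul, Matrix.mul_assoc]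
  refine ⟨U * diagonal (fun i => (d i)⁻¹) * Uᵀ, ⟨?_, ?_, ?_, ?_⟩, symm _⟩
  · rw [hAU, key, key]
    simp only [mul_inv_mul_cancel]
  · rw [hAU, key, key]
    congr 3
    funext i
    by_cases h : d i = 0 <;> simp [h]
  · rw [hAU, key, symm]
  · rw [hAU, key, symm]

/-- Every real matrix has a Moore-Penrose pseudoinverse. -/
theorem IsMoorePenrose.exists {m n : Type*} [Fintype m] [Fintype n]
    (A : Matrix m n ℝ) : ∃ B, IsMoorePenrose A B := by
  classical
  obtain ⟨G, hG, hGs⟩ := IsMoorePenrose.exists_of_isSymm (Aᵀ * A) (by simp [Matrix.transpose_mul])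
  have h0 : A * G * (Aᵀ * A) - A = 0 := by
    rw [← Matrix.conjTranspose_mul_self_eq_zero, Matrix.conjTranspose_eq_transpose_of_trivial]
    have e1 : Aᵀ * (A * G * (Aᵀ * A) - A) = 0 := by
      have := hG.mul_mul_left
      rw [Matrix.mul_sub, sub_eq_zero]
      simpa only [Matrix.mul_assoc] using this
    have e2 : (A * G * (Aᵀ * A) - A)ᵀ = (Aᵀ * A * G - 1) * Aᵀ := by
      simp [Matrix.transpose_mul, Matrix.sub_mul, Matrix.mul_assoc, hGs]
    rw [e2, Matrix.mul_assoc, e1, Matrix.mul_zero]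
  refine ⟨G * Aᵀ, ⟨?_, ?_, ?_, ?_⟩⟩
  · rw [sub_eq_zero] at h0
    simpa only [Matrix.mul_assoc] using h0
  · have := congrArg (· * Aᵀ) hG.mul_mul_right
    simpa only [Matrix.mul_assoc] using this
  · simp [Matrix.transpose_mul, hGs, Matrix.mul_assoc]
  · have := hG.symm_right
    simpa only [Matrix.mul_assoc] using this

/-- The Moore-Penrose pseudoinverse of a real matrix. -/
noncomputable def pinv {m n : Type*} [Fintype m] [Fintype n]
    (A : Matrix m n ℝ) : Matrix n m ℝ :=
  (IsMoorePenrose.exists A).choose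

theorem pinv_isMoorePenrose {m n : Type*} [Fintype m] [Fintype n]
    (A : Matrix m n ℝ) : IsMoorePenrose A (pinv A) :=
  (IsMoorePenrose.exists A).choose_spec

/-! ### Partial derivatives indexed by multi-indices -/

/-- The first partial derivative of `f` in the `k`-th coordinate direction. -/
noncomputable def coordDeriv {N : ℕ} (k : Fin N) (f : EuclideanSpace ℝ (Fin N) → ℝ) :
    EuclideanSpace ℝ (Fin N) → ℝ :=
  fun x => lineDeriv ℝ f x (EuclideanSpace.single k 1)

/-- The partial derivative `∂₁^{p₁} ⋯ ∂_N^{p_N} f` as an iterated partial derivative. -/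
noncomputable def multiDeriv {N : ℕ} (p : Fin N → ℕ) (f : EuclideanSpace ℝ (Fin N) → ℝ) :
    EuclideanSpace ℝ (Fin N) → ℝ :=
  (List.finRange N).foldr (fun k g => (coordDeriv k)^[p k] g) f

/-- The multi-index binomial coefficient. -/
def multiChoose {N : ℕ} (q p : Fin N → ℕ) : ℕ := ∏ k, (q k).choose (p k)

/-! ### Canonical exponential families -/

/-- The data of a canonical exponential family on `ℝ^M` with parameters in `ℝ^N`: a sufficient
statistic `φ` and a nonnegative weight function `h` that does not vanish almost everywhere. -/
structure CanonicalExpFamily (M N : ℕ) where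
  φ : EuclideanSpace ℝ (Fin M) → EuclideanSpace ℝ (Fin N)
  h : EuclideanSpace ℝ (Fin M) → ℝ
  measurable_φ : Measurable φ
  measurable_h : Measurable h
  h_nonneg : ∀ y, 0 ≤ h y
  h_ne_zero : ¬ (h =ᵐ[volume] 0)

namespace CanonicalExpFamily

variable {M N : ℕ} (F : CanonicalExpFamily M N)

/-- The natural parameter space `{x | ∫ exp (φ(y)ᵀ x) h(y) dy < ∞}`. -/
def naturalSpace : Set (EuclideanSpace ℝ (Fin N)) :=
  {x | ∫⁻ y, ENNReal.ofReal (Real.exp (inner ℝ (F.φ y) x) * F.h y) < ⊤}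

/-- The moment-generating function `λ(x) = ∫ exp (φ(y)ᵀ x) h(y) dy`. -/
noncomputable def mgf (x : EuclideanSpace ℝ (Fin N)) : ℝ :=
  ∫ y, Real.exp (inner ℝ (F.φ y) x) * F.h y

/-- The cumulant function `A(x) = log λ(x)`. -/
noncomputable def cumulant (x : EuclideanSpace ℝ (Fin N)) : ℝ := Real.log (F.mgf x)

/-- The probability density `f(y; x) = exp (φ(y)ᵀ x - A(x)) h(y)`. -/
noncomputable def density (x : EuclideanSpace ℝ (Fin N)) (y : EuclideanSpace ℝ (Fin M)) : ℝ :=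
  Real.exp (inner ℝ (F.φ y) x - F.cumulant x) * F.h y

/-- The distribution of the observation under parameter `x`: the measure with density `f(·; x)`
with respect to Lebesgue measure. -/
noncomputable def law (x : EuclideanSpace ℝ (Fin N)) : Measure (EuclideanSpace ℝ (Fin M)) :=
  volume.withDensity fun y => ENNReal.ofReal (F.density x y)

/-- The monomial `φ^p(y) = ∏ₖ φₖ(y)^{pₖ}`. -/
noncomputable def monomial (p : Fin N → ℕ) (y : EuclideanSpace ℝ (Fin M)) : ℝ :=
  ∏ k, F.φ y k ^ p k

/-- The moment `E_x {φ^p(y)}`. -/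
noncomputable def moment (x : EuclideanSpace ℝ (Fin N)) (p : Fin N → ℕ) : ℝ :=
  ∫ y, F.monomial p y ∂(F.law x)

/-- The matrix with entries `E_x {φ^{p_l + p_l'}(y)}`. -/
noncomputable def momentMatrix {L : ℕ} (p : Fin L → Fin N → ℕ) (x : EuclideanSpace ℝ (Fin N)) :
    Matrix (Fin L) (Fin L) ℝ :=
  Matrix.of fun l l' => F.moment x (p l + p l')

/-- The vector with entries `∑_{q ≤ p_l} binom(p_l, q) E_x {φ^{p_l - q}(y)} ∂^q γ(x)`. -/
noncomputable def derivVector {L : ℕ} (p : Fin L → Fin N → ℕ)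
    (γ : EuclideanSpace ℝ (Fin N) → ℝ) (x : EuclideanSpace ℝ (Fin N)) : Fin L → ℝ :=
  fun l => ∑ q ∈ Finset.Iic (p l),
    (multiChoose (p l) q : ℝ) * F.moment x (p l - q) * multiDeriv q γ x

end CanonicalExpFamily

/-! Write λ for the moment-generating function. Multiplying by λ removes the normalisation: γ(x)
λ(x) = ∫ g h exp ⟪φ, x⟫ on the interior of the parameter set. Differentiating under the integral,
∂^p of the right side at x₀ is λ(x₀) E{φ^p g}, and ∂^r λ(x₀) = λ(x₀) E{φ^r}. The Leibniz rule on the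
left side (`multiDeriv_mul`) therefore identifies n_l with E{φ^{p_l} g}. As S is the Gram matrix of
the φ^{p_l} in L² of the law at x₀, nᵀ S† n is the squared length of the projection of g onto their
span, hence at most E{g²} (`dotProduct_pinv_gram_mulVec_le`). Subtracting γ(x₀)² turns E{g²} into
the variance.

Two estimates justify the calculus. Integrability of g at x follows from |g| a ≤ g² + a² with a =
exp ⟪φ, x - x₀⟫: weighting a² by the density at x₀ gives the parameter 2x - x₀. Differentiation
under the integral, and existence of all moments, rest on dominating ‖v‖ exp ⟪v, u⟫, locally
uniformly in u, by finitely many exponentials. -/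

theorem EuclideanSpace.norm_le_sum_abs {N : ℕ} (v : EuclideanSpace ℝ (Fin N)) :
    ‖v‖ ≤ ∑ k, |v k| := by
  have h0 : 0 ≤ ∑ k, |v k| := Finset.sum_nonneg fun _ _ => abs_nonneg _
  rw [← abs_of_nonneg h0, ← abs_norm]
  apply sq_le_sq.mp
  rw [EuclideanSpace.norm_sq_eq]
  simpa using Finset.sum_sq_le_sq_sum_of_nonneg (s := Finset.univ) (f := fun k => |v k|)
    fun _ _ => abs_nonneg _

/-- Near an interior point of `U`, the functions `‖v‖ exp ⟪v, u⟫` of `v` are dominated by a finite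
sum of exponentials `exp ⟪v, t⟫` with `t ∈ U`. -/
theorem exists_norm_mul_exp_inner_le {N : ℕ} {U : Set (EuclideanSpace ℝ (Fin N))} (hU : IsOpen U)
    {u₀ : EuclideanSpace ℝ (Fin N)} (hu₀ : u₀ ∈ U) :
    ∃ ε > 0, ∃ C : ℝ, ∃ t : (Fin N → Bool) → EuclideanSpace ℝ (Fin N), (∀ s, t s ∈ U) ∧
      ∀ u ∈ Metric.ball u₀ ε, ∀ v : EuclideanSpace ℝ (Fin N),
        ‖v‖ * Real.exp (inner ℝ v u) ≤ C * ∑ s, Real.exp (inner ℝ v (t s)) := by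
  obtain ⟨r, hr, hrU⟩ := Metric.isOpen_iff.mp hU u₀ hu₀
  -- The vertices of the cube [-1, 1]^N; the vertex with the signs of v satisfies ⟪v, σ s⟫ = ∑ |v k|
  -- ≥ ‖v‖.
  let σ : (Fin N → Bool) → EuclideanSpace ℝ (Fin N) :=
    fun s => WithLp.toLp 2 fun k => if s k then 1 else -1
  set R : ℝ := ∑ s, ‖σ s‖ + 1 with hR
  have hR0 : 0 < R := by positivity
  have hσ : ∀ s, ‖σ s‖ < R := fun s => by
    have := Finset.single_le_sum (f := fun s => ‖σ s‖) (fun _ _ => norm_nonneg _)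
      (Finset.mem_univ s)
    linarith
  -- Of the shift 2ε, one ε absorbs the factor ‖v‖ through t ≤ exp t, the other the displacement of
  -- u from u₀; 2εR = r keeps the shifted points in the ball.
  set ε : ℝ := r / R / 2 with hε
  have hε0 : 0 < ε := by positivity
  refine ⟨ε, hε0, ε⁻¹, fun s => u₀ + (2 * ε) • σ s, fun s => hrU ?_, fun u hu v => ?_⟩
  · rw [Metric.mem_ball, dist_eq_norm, add_sub_cancel_left, norm_smul, Real.norm_of_nonneg
      (by positivity)]
    calc 2 * ε * ‖σ s‖ < 2 * ε * R := by gcongr; exact hσ s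
      _ = r := by rw [hε]; field_simp
  · let s : Fin N → Bool := fun k => decide (0 ≤ v k)
    have hs : ‖v‖ ≤ inner ℝ v (σ s) := by
      refine (EuclideanSpace.norm_le_sum_abs v).trans (le_of_eq ?_)
      rw [PiLp.inner_apply]
      refine Finset.sum_congr rfl fun k _ => ?_
      by_cases hk : 0 ≤ v k
      · simp [σ, s, hk, abs_of_nonneg hk]
      · simp [σ, s, hk, abs_of_neg (not_le.mp hk)]
    have h1 : ‖v‖ ≤ ε⁻¹ * Real.exp (ε * ‖v‖) := by
      rw [inv_mul_eq_div, le_div_iff₀ hε0, mul_comm]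
      linarith [Real.add_one_le_exp (ε * ‖v‖)]
    have h2 : inner ℝ v u ≤ inner ℝ v u₀ + ε * ‖v‖ := by
      have h3 := real_inner_le_norm v (u - u₀)
      rw [Metric.mem_ball, dist_eq_norm] at hu
      rw [inner_sub_right] at h3
      nlinarith [norm_nonneg v]
    calc ‖v‖ * Real.exp (inner ℝ v u)
        ≤ (ε⁻¹ * Real.exp (ε * ‖v‖)) * Real.exp (inner ℝ v u₀ + ε * ‖v‖) := by gcongr
      _ = ε⁻¹ * Real.exp (inner ℝ v u₀ + 2 * ε * ‖v‖) := by
        rw [mul_assoc, ← Real.exp_add]; ring_nf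
      _ ≤ ε⁻¹ * Real.exp (inner ℝ v (u₀ + (2 * ε) • σ s)) := by
        rw [inner_add_right, inner_smul_right]
        gcongr
      _ ≤ _ := by
        gcongr
        exact Finset.single_le_sum (f := fun s => Real.exp (inner ℝ v (u₀ + (2 * ε) • σ s)))
          (fun _ _ => (Real.exp_pos _).le) (Finset.mem_univ s)

/-! ### Exponential integrals and differentiation under the integral sign -/

section ExpIntegral

variable {Y : Type*} [MeasurableSpace Y] {N : ℕ}

/-- The integral `∫ w(y) exp ⟪φ(y), u⟫ dμ(y)`, as a function of `u`. -/
noncomputable def expIntegral (μ : Measure Y) (φ : Y → EuclideanSpace ℝ (Fin N)) (w : Y → ℝ)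
    (u : EuclideanSpace ℝ (Fin N)) : ℝ :=
  ∫ y, w y * Real.exp (inner ℝ (φ y) u) ∂μ

/-- The weight `w` is measurable and `w(y) exp ⟪φ(y), u⟫` is integrable for all `u ∈ U`. -/
structure ExpIntegrableOn (μ : Measure Y) (φ : Y → EuclideanSpace ℝ (Fin N)) (w : Y → ℝ)
    (U : Set (EuclideanSpace ℝ (Fin N))) : Prop where
  measurable : Measurable w
  integrable : ∀ u ∈ U, Integrable (fun y => w y * Real.exp (inner ℝ (φ y) u)) μ

variable {μ : Measure Y} {φ : Y → EuclideanSpace ℝ (Fin N)} {w : Y → ℝ}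
  {U : Set (EuclideanSpace ℝ (Fin N))}

/-- A single dominating function, used both for integrability after multiplying by φ and for
dominated differentiation. -/
theorem ExpIntegrableOn.exists_bound (hw : ExpIntegrableOn μ φ w U)
    (hU : IsOpen U) {u₀ : EuclideanSpace ℝ (Fin N)} (hu₀ : u₀ ∈ U) :
    ∃ ε > 0, ∃ b : Y → ℝ, Integrable b μ ∧ ∀ u ∈ Metric.ball u₀ ε, ∀ y,
      |w y| * (‖φ y‖ * Real.exp (inner ℝ (φ y) u)) ≤ b y := by
  obtain ⟨ε, hε, C, t, ht, h⟩ := exists_norm_mul_exp_inner_le hU hu₀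
  refine ⟨ε, hε, fun y => C * ∑ s, |w y * Real.exp (inner ℝ (φ y) (t s))|, ?_, fun u hu y => ?_⟩
  · exact (integrable_finsetSum _ fun s _ => (hw.integrable _ (ht s)).abs).const_mul C
  · calc _ ≤ |w y| * (C * ∑ s, Real.exp (inner ℝ (φ y) (t s))) := 
        mul_le_mul_of_nonneg_left (h u hu _) (abs_nonneg _)
      _ = _ := by
        simp only [abs_mul, Real.abs_exp, ← Finset.mul_sum]
        ring

/-- Admissible weights are stable under differentiation, so it can be iterated. -/
theorem ExpIntegrableOn.inner_mul (hw : ExpIntegrableOn μ φ w U) (hφ : Measurable φ)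
    (hU : IsOpen U) (v : EuclideanSpace ℝ (Fin N)) :
    ExpIntegrableOn μ φ (fun y => inner ℝ (φ y) v * w y) U where
  measurable := (hφ.inner measurable_const).mul hw.measurable
  integrable u hu := by
    obtain ⟨ε, hε, b, hb, h⟩ := hw.exists_bound hU hu
    refine (hb.const_mul ‖v‖).mono' ?_ (Filter.Eventually.of_forall fun y => ?_)
    · exact (((hφ.inner measurable_const).mul hw.measurable).mul
        (hφ.inner measurable_const).exp).aestronglyMeasurable
    · rw [norm_mul, norm_mul, Real.norm_eq_abs, Real.norm_eq_abs, Real.norm_eq_abs, Real.abs_exp]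
      calc _ ≤ (‖φ y‖ * ‖v‖) * |w y| * Real.exp (inner ℝ (φ y) u) := by
            gcongr
            exact abs_real_inner_le_norm _ _
        _ = ‖v‖ * (|w y| * (‖φ y‖ * Real.exp (inner ℝ (φ y) u))) := by ring
        _ ≤ _ := by gcongr; exact h u (Metric.mem_ball_self hε) y

theorem ExpIntegrableOn.hasFDerivAt (hw : ExpIntegrableOn μ φ w U) (hφ : Measurable φ)
    (hU : IsOpen U) {u : EuclideanSpace ℝ (Fin N)} (hu : u ∈ U) :
    ∃ f' : EuclideanSpace ℝ (Fin N) →L[ℝ] ℝ, HasFDerivAt (expIntegral μ φ w) f' u ∧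
      ∀ v, f' v = expIntegral μ φ (fun y => inner ℝ (φ y) v * w y) u := by
  obtain ⟨ε, hε, b, hb, h⟩ := hw.exists_bound hU hu
  let F' : EuclideanSpace ℝ (Fin N) → Y → EuclideanSpace ℝ (Fin N) →L[ℝ] ℝ :=
    fun x y => (w y * Real.exp (inner ℝ (φ y) x)) • innerSL ℝ (φ y)
  have hmeas : ∀ x, Measurable fun y => w y * Real.exp (inner ℝ (φ y) x) := fun x =>
    hw.measurable.mul (hφ.inner measurable_const).exp
  have hF'meas : ∀ x, AEStronglyMeasurable (F' x) μ := fun x =>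
    (hmeas x).aestronglyMeasurable.smul
      ((innerSL ℝ).continuous.comp_aestronglyMeasurable hφ.aestronglyMeasurable)
  have hbound : ∀ x ∈ Metric.ball u ε, ∀ y, ‖F' x y‖ ≤ b y := fun x hx y => by
    rw [norm_smul, innerSL_apply_norm, norm_mul, Real.norm_eq_abs, Real.norm_eq_abs, Real.abs_exp]
    calc _ = |w y| * (‖φ y‖ * Real.exp (inner ℝ (φ y) x)) := by ring
      _ ≤ _ := h x hx y
  have hint : Integrable (F' u) μ := hb.mono' (hF'meas u)
    (Filter.Eventually.of_forall fun y => hbound u (Metric.mem_ball_self hε) y)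
  refine ⟨∫ y, F' u y ∂μ, ?_, fun v => ?_⟩
  · refine hasFDerivAt_integral_of_dominated_of_fderiv_le (F' := F') (bound := b)
      (Metric.ball_mem_nhds u hε)
      (Filter.Eventually.of_forall fun x => (hmeas x).aestronglyMeasurable)
      (hw.integrable u hu) (hF'meas u)
      (Filter.Eventually.of_forall fun y x hx => hbound x hx y) hb
      (Filter.Eventually.of_forall fun y x _ => ?_)
    have h1 : HasFDerivAt (fun x => inner ℝ (φ y) x) (innerSL ℝ (φ y)) x :=
      (innerSL ℝ (φ y)).hasFDerivAt
    have h2 := h1.exp.const_mul (w y)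
    rwa [smul_smul] at h2
  · rw [ContinuousLinearMap.integral_apply hint]
    refine integral_congr_ae (Filter.Eventually.of_forall fun y => ?_)
    simp only [F', _root_.smul_apply, innerSL_apply_apply, smul_eq_mul]
    ring

/-- Each directional derivative is an exponential integral with another weight, so the induction
must range over all w. -/
theorem ExpIntegrableOn.contDiffOn_nat (hφ : Measurable φ) (hU : IsOpen U) (n : ℕ) :
    ∀ {w : Y → ℝ}, ExpIntegrableOn μ φ w U → ContDiffOn ℝ n (expIntegral μ φ w) U := by
  induction n with
  | zero =>
    intro w hw
    rw [Nat.cast_zero, contDiffOn_zero]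
    intro u hu
    obtain ⟨f', hf', -⟩ := hw.hasFDerivAt hφ hU hu
    exact hf'.continuousAt.continuousWithinAt
  | succ n ih =>
    intro w hw
    rw [Nat.cast_succ, contDiffOn_succ_iff_fderiv_apply hU.uniqueDiffOn]
    refine ⟨fun u hu => ?_, by simp, fun v => ?_⟩
    · obtain ⟨f', hf', -⟩ := hw.hasFDerivAt hφ hU hu
      exact hf'.differentiableAt.differentiableWithinAt
    · refine (ih (hw.inner_mul hφ hU v)).congr fun u hu => ?_
      obtain ⟨f', hf', hv⟩ := hw.hasFDerivAt hφ hU hu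
      rw [fderivWithin_of_isOpen hU hu, hf'.fderiv, hv]

theorem ExpIntegrableOn.contDiffOn (hw : ExpIntegrableOn μ φ w U) (hφ : Measurable φ)
    (hU : IsOpen U) : ContDiffOn ℝ ∞ (expIntegral μ φ w) U :=
  contDiffOn_infty.mpr fun n => contDiffOn_nat hφ hU n hw

theorem ExpIntegrableOn.apply_mul (hw : ExpIntegrableOn μ φ w U) (hφ : Measurable φ)
    (hU : IsOpen U) (k : Fin N) : ExpIntegrableOn μ φ (fun y => φ y k * w y) U := by
  simpa [EuclideanSpace.inner_single_right] using hw.inner_mul hφ hU (EuclideanSpace.single k 1)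

theorem ExpIntegrableOn.coordDeriv_eqOn (hw : ExpIntegrableOn μ φ w U) (hφ : Measurable φ)
    (hU : IsOpen U) (k : Fin N) :
    Set.EqOn (coordDeriv k (expIntegral μ φ w)) (expIntegral μ φ fun y => φ y k * w y) U := by
  intro u hu
  obtain ⟨f', hf', hv⟩ := hw.hasFDerivAt hφ hU hu
  rw [coordDeriv, hf'.differentiableAt.lineDeriv_eq_fderiv, hf'.fderiv, hv]
  simp [EuclideanSpace.inner_single_right]

end ExpIntegral

/-! ### Iterated partial derivatives and the Leibniz rule -/

section CoordDeriv

variable {N : ℕ} {U : Set (EuclideanSpace ℝ (Fin N))} {f g : EuclideanSpace ℝ (Fin N) → ℝ}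

theorem coordDeriv_congr (hU : IsOpen U) (h : Set.EqOn f g U) (k : Fin N) :
    Set.EqOn (coordDeriv k f) (coordDeriv k g) U := fun _ hx =>
  (Filter.eventuallyEq_of_mem (hU.mem_nhds hx) h).lineDeriv_eq

theorem iterate_coordDeriv_congr (hU : IsOpen U) (h : Set.EqOn f g U) (k : Fin N) (n : ℕ) :
    Set.EqOn ((coordDeriv k)^[n] f) ((coordDeriv k)^[n] g) U := by
  induction n with
  | zero => exact h
  | succ n ih =>
    simp only [Function.iterate_succ_apply']
    exact coordDeriv_congr hU ih k

theorem ContDiffOn.differentiableAt_of_isOpen (hf : ContDiffOn ℝ ∞ f U) (hU : IsOpen U)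
    {x : EuclideanSpace ℝ (Fin N)} (hx : x ∈ U) : DifferentiableAt ℝ f x :=
  (hf.differentiableOn (by simp)).differentiableAt (hU.mem_nhds hx)

theorem ContDiffOn.coordDeriv (hf : ContDiffOn ℝ ∞ f U) (hU : IsOpen U) (k : Fin N) :
    ContDiffOn ℝ ∞ (coordDeriv k f) U := by
  have h := (hf.fderiv_of_isOpen hU (m := ∞) (by simp)).clm_apply
    (contDiffOn_const (c := EuclideanSpace.single k (1 : ℝ)))
  exact h.congr fun x hx => (hf.differentiableAt_of_isOpen hU hx).lineDeriv_eq_fderiv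

theorem ContDiffOn.iterate_coordDeriv (hf : ContDiffOn ℝ ∞ f U) (hU : IsOpen U) (k : Fin N)
    (n : ℕ) : ContDiffOn ℝ ∞ ((_root_.coordDeriv k)^[n] f) U := by
  induction n with
  | zero => exact hf
  | succ n ih =>
    rw [Function.iterate_succ_apply']
    exact ih.coordDeriv hU k

theorem coordDeriv_mul (hU : IsOpen U) (hf : ContDiffOn ℝ ∞ f U) (hg : ContDiffOn ℝ ∞ g U)
    (k : Fin N) :
    Set.EqOn (coordDeriv k (fun x => f x * g x))
      (fun x => f x * coordDeriv k g x + coordDeriv k f x * g x) U := fun x hx => by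
  have hf' := hf.differentiableAt_of_isOpen hU hx
  have hg' := hg.differentiableAt_of_isOpen hU hx
  simp only [coordDeriv]
  rw [(hf'.fun_mul hg').lineDeriv_eq_fderiv, hf'.lineDeriv_eq_fderiv, hg'.lineDeriv_eq_fderiv,
    fderiv_fun_mul hf' hg']
  simp [mul_comm]

theorem coordDeriv_sum {ι : Type*} (hU : IsOpen U) {s : Finset ι} (c : ι → ℝ)
    {f : ι → EuclideanSpace ℝ (Fin N) → ℝ} (hf : ∀ i ∈ s, ContDiffOn ℝ ∞ (f i) U) (k : Fin N) :
    Set.EqOn (coordDeriv k (fun x => ∑ i ∈ s, c i * f i x))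
      (fun x => ∑ i ∈ s, c i * coordDeriv k (f i) x) U := fun x hx => by
  have hf' := fun i hi => (hf i hi).differentiableAt_of_isOpen hU hx
  simp only [coordDeriv]
  rw [(DifferentiableAt.fun_sum fun i hi => (hf' i hi).const_mul (c i)).lineDeriv_eq_fderiv,
    fderiv_fun_sum fun i hi => (hf' i hi).const_mul (c i), _root_.sum_apply]
  refine Finset.sum_congr rfl fun i hi => ?_
  rw [(hf' i hi).lineDeriv_eq_fderiv, fderiv_const_mul (hf' i hi)]
  simp

theorem iterate_coordDeriv_sum {ι : Type*} (hU : IsOpen U) {s : Finset ι} (c : ι → ℝ)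
    {f : ι → EuclideanSpace ℝ (Fin N) → ℝ} (hf : ∀ i ∈ s, ContDiffOn ℝ ∞ (f i) U) (k : Fin N)
    (n : ℕ) :
    Set.EqOn ((coordDeriv k)^[n] (fun x => ∑ i ∈ s, c i * f i x))
      (fun x => ∑ i ∈ s, c i * (coordDeriv k)^[n] (f i) x) U := by
  induction n with
  | zero => exact fun _ _ => rfl
  | succ n ih =>
    simp only [Function.iterate_succ_apply']
    exact (coordDeriv_congr hU ih k).trans
      (coordDeriv_sum hU c (fun i hi => (hf i hi).iterate_coordDeriv hU k n) k)

theorem iterate_coordDeriv_mul (hU : IsOpen U) (hf : ContDiffOn ℝ ∞ f U)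
    (hg : ContDiffOn ℝ ∞ g U) (k : Fin N) (n : ℕ) :
    Set.EqOn ((coordDeriv k)^[n] (fun x => f x * g x))
      (fun x => ∑ i ∈ Finset.range (n + 1), (n.choose i : ℝ) *
        ((coordDeriv k)^[i] f x * (coordDeriv k)^[n - i] g x)) U := by
  induction n with
  | zero => intro x _; simp
  | succ n ih =>
    rw [Function.iterate_succ_apply']
    have hF := hf.iterate_coordDeriv hU k
    have hG := hg.iterate_coordDeriv hU k
    refine ((coordDeriv_congr hU ih k).trans
      (coordDeriv_sum hU _ (fun i _ => (hF i).mul (hG (n - i))) k)).trans fun x hx => ?_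
    have h := Finset.sum_choose_succ_mul
      (fun i j => (coordDeriv k)^[i] f x * (coordDeriv k)^[j] g x) n
    simp only at h ⊢
    rw [h, ← Finset.sum_add_distrib]
    refine Finset.sum_congr rfl fun i hi => ?_
    rw [coordDeriv_mul hU (hF i) (hG (n - i)) k hx,
      Nat.succ_sub (Nat.lt_succ_iff.mp (Finset.mem_range.mp hi))]
    simp only [Function.iterate_succ_apply']
    ring

/-- Iterated partial derivatives of orders `p i` in the coordinate directions `v i`. -/
noncomputable def iterCoordDeriv {n : ℕ} (v : Fin n → Fin N) (p : Fin n → ℕ)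
    (f : EuclideanSpace ℝ (Fin N) → ℝ) : EuclideanSpace ℝ (Fin N) → ℝ :=
  (List.finRange n).foldr (fun k g => (coordDeriv (v k))^[p k] g) f

/-- Separating the number n of directions from the dimension N makes induction on n possible. -/
theorem iterCoordDeriv_succ {n : ℕ} (v : Fin (n + 1) → Fin N) (p : Fin (n + 1) → ℕ) :
    iterCoordDeriv v p f =
      (coordDeriv (v 0))^[p 0] (iterCoordDeriv (Fin.tail v) (Fin.tail p) f) := by
  simp only [iterCoordDeriv, List.finRange_succ, List.foldr_cons, List.foldr_map]
  rfl

theorem ContDiffOn.iterCoordDeriv (hU : IsOpen U) (hf : ContDiffOn ℝ ∞ f U) {n : ℕ}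
    (v : Fin n → Fin N) (p : Fin n → ℕ) : ContDiffOn ℝ ∞ (iterCoordDeriv v p f) U := by
  induction n with
  | zero => exact hf
  | succ n ih =>
    rw [iterCoordDeriv_succ]
    exact (ih _ _).iterate_coordDeriv hU _ _

theorem Fin.sum_Iic_succ {n : ℕ} (p : Fin (n + 1) → ℕ) (F : (Fin (n + 1) → ℕ) → ℝ) :
    ∑ q ∈ Finset.Iic p, F q =
      ∑ q ∈ Finset.Iic (Fin.tail p), ∑ i ∈ Finset.range (p 0 + 1), F (Fin.cons i q) := by
  rw [← Finset.sum_product']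
  refine Finset.sum_nbij' (fun q => (Fin.tail q, q 0)) (fun q => Fin.cons q.2 q.1) ?_ ?_ ?_ ?_ ?_
  · intro q hq
    simp only [Finset.mem_Iic, Finset.mem_product, Finset.mem_range, Nat.lt_succ_iff] at hq ⊢
    exact ⟨fun k => hq k.succ, hq 0⟩
  · rintro ⟨q, i⟩ hq
    simp only [Finset.mem_Iic, Finset.mem_product, Finset.mem_range, Nat.lt_succ_iff] at hq ⊢
    refine fun k => Fin.cases ?_ (fun k => ?_) k
    · simpa using hq.2
    · exact hq.1 k
  · intro q _
    exact Fin.cons_self_tail q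
  · rintro ⟨q, i⟩ _
    simp
  · intro q _
    simp only [Fin.cons_self_tail]

/-- The Leibniz rule for iterated partial derivatives. -/
theorem iterCoordDeriv_mul (hU : IsOpen U) (hf : ContDiffOn ℝ ∞ f U) (hg : ContDiffOn ℝ ∞ g U)
    {n : ℕ} (v : Fin n → Fin N) (p : Fin n → ℕ) :
    Set.EqOn (iterCoordDeriv v p (fun x => f x * g x))
      (fun x => ∑ q ∈ Finset.Iic p, (multiChoose p q : ℝ) *
        (iterCoordDeriv v q f x * iterCoordDeriv v (p - q) g x)) U := by
  induction n with
  | zero =>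
    intro x _
    have : Finset.Iic p = {p} := by ext q; simp [Subsingleton.elim q p]
    simp [iterCoordDeriv, this, multiChoose]
  | succ n ih =>
    rw [iterCoordDeriv_succ]
    have hF := fun q => hf.iterCoordDeriv hU (Fin.tail v) q
    have hG := fun q => hg.iterCoordDeriv hU (Fin.tail v) q
    refine ((iterate_coordDeriv_congr hU (ih _ _) _ _).trans
      (iterate_coordDeriv_sum hU _ (fun q _ => (hF q).mul (hG _)) _ _)).trans fun x hx => ?_
    simp only
    rw [Fin.sum_Iic_succ]
    refine Finset.sum_congr rfl fun q _ => ?_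
    rw [iterate_coordDeriv_mul hU (hF q) (hG _) _ _ hx, Finset.mul_sum]
    refine Finset.sum_congr rfl fun i _ => ?_
    simp only [iterCoordDeriv_succ, multiChoose, Fin.prod_univ_succ, Fin.cons_zero, Fin.cons_succ,
      Fin.tail_cons, Pi.sub_apply, Fin.tail]
    have : Fin.tail (p - Fin.cons i q) = Fin.tail p - q := by
      ext k; simp [Fin.tail]
    rw [this]
    push_cast
    ring

/-- The Leibniz rule for multi-index partial derivatives. -/
theorem multiDeriv_mul (hU : IsOpen U) (hf : ContDiffOn ℝ ∞ f U) (hg : ContDiffOn ℝ ∞ g U)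
    (p : Fin N → ℕ) :
    Set.EqOn (multiDeriv p (fun x => f x * g x))
      (fun x => ∑ q ∈ Finset.Iic p, (multiChoose p q : ℝ) *
        (multiDeriv q f x * multiDeriv (p - q) g x)) U :=
  -- For n = N and v = id, `iterCoordDeriv` unfolds to `multiDeriv`.
  iterCoordDeriv_mul hU hf hg id p

theorem multiDeriv_congr (hU : IsOpen U) (h : Set.EqOn f g U) (p : Fin N → ℕ) :
    Set.EqOn (multiDeriv p f) (multiDeriv p g) U := by
  rw [multiDeriv, multiDeriv]
  induction List.finRange N with
  | nil => exact h
  | cons k l ih => exact iterate_coordDeriv_congr hU ih k (p k)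

end CoordDeriv

/-! ### Higher derivatives of exponential integrals as weighted monomials -/

section ExpIntegral

variable {Y : Type*} [MeasurableSpace Y] {N : ℕ} {μ : Measure Y}
  {φ : Y → EuclideanSpace ℝ (Fin N)} {w : Y → ℝ} {U : Set (EuclideanSpace ℝ (Fin N))}

theorem ExpIntegrableOn.iterate_coordDeriv (hw : ExpIntegrableOn μ φ w U) (hφ : Measurable φ)
    (hU : IsOpen U) (k : Fin N) (n : ℕ) :
    ExpIntegrableOn μ φ (fun y => φ y k ^ n * w y) U ∧
    Set.EqOn ((coordDeriv k)^[n] (expIntegral μ φ w))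
      (expIntegral μ φ fun y => φ y k ^ n * w y) U := by
  induction n with
  | zero =>
    simp only [pow_zero, one_mul]
    exact ⟨hw, fun _ _ => rfl⟩
  | succ n ih =>
    simp only [pow_succ', mul_assoc, Function.iterate_succ_apply']
    exact ⟨ih.1.apply_mul hφ hU k,
      (coordDeriv_congr hU ih.2 k).trans (ih.1.coordDeriv_eqOn hφ hU k)⟩

theorem ExpIntegrableOn.multiDeriv (hw : ExpIntegrableOn μ φ w U) (hφ : Measurable φ)
    (hU : IsOpen U) (q : Fin N → ℕ) :
    ExpIntegrableOn μ φ (fun y => (∏ k, φ y k ^ q k) * w y) U ∧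
    Set.EqOn (multiDeriv q (expIntegral μ φ w))
      (expIntegral μ φ fun y => (∏ k, φ y k ^ q k) * w y) U := by
  simp only [Fin.prod_univ_def, _root_.multiDeriv]
  induction List.finRange N with
  | nil =>
    simp only [List.map_nil, List.prod_nil, one_mul, List.foldr_nil]
    exact ⟨hw, fun _ _ => rfl⟩
  | cons k l ih =>
    have h := ih.1.iterate_coordDeriv hφ hU k (q k)
    simp only [List.map_cons, List.prod_cons, mul_assoc, List.foldr_cons]
    exact ⟨h.1, (iterate_coordDeriv_congr hU ih.2 k (q k)).trans h.2⟩

end ExpIntegral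

/-! ### Bessel's inequality with a possibly singular Gram matrix -/

theorem pinv_transpose_of_isSymm {n : Type*} [Fintype n] {A : Matrix n n ℝ} (hA : Aᵀ = A) :
    (pinv A)ᵀ = pinv A := by
  classical
  obtain ⟨B, hB, hBs⟩ := IsMoorePenrose.exists_of_isSymm A hA
  rw [(pinv_isMoorePenrose A).unique hB, hBs]

/-- Bessel's inequality in terms of the pseudoinverse of the Gram matrix. -/
theorem dotProduct_pinv_gram_mulVec_le {Ω ι : Type*} [MeasurableSpace Ω] [Fintype ι]
    {P : Measure Ω} {g : Ω → ℝ} {f : ι → Ω → ℝ} (hgg : Integrable (fun y => g y ^ 2) P)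
    (hfg : ∀ i, Integrable (fun y => f i y * g y) P)
    (hff : ∀ i j, Integrable (fun y => f i y * f j y) P)
    {n : ι → ℝ} (hn : ∀ i, n i = ∫ y, f i y * g y ∂P)
    {S : Matrix ι ι ℝ} (hS : ∀ i j, S i j = ∫ y, f i y * f j y ∂P) :
    n ⬝ᵥ (pinv S *ᵥ n) ≤ ∫ y, g y ^ 2 ∂P := by
  have hSs : Sᵀ = S := by
    ext i j
    rw [Matrix.transpose_apply, hS, hS]
    simp only [mul_comm]
  -- Coefficients of the projection of g. By S† S S† = S† and the symmetry of S†, aᵀ S a = nᵀ a, so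
  -- ∫ (g - ∑ aᵢ fᵢ)² ≥ 0 reads ∫ g² - nᵀ a ≥ 0.
  set a := pinv S *ᵥ n with ha
  have haSa : a ⬝ᵥ (S *ᵥ a) = n ⬝ᵥ a := by
    have h : a = n ᵥ* pinv S := by
      rw [ha, ← Matrix.mulVec_transpose, pinv_transpose_of_isSymm hSs]
    calc a ⬝ᵥ (S *ᵥ a) = (n ᵥ* pinv S) ⬝ᵥ (S *ᵥ (pinv S *ᵥ n)) := by rw [← h, ← ha]
      _ = n ⬝ᵥ ((pinv S * S * pinv S) *ᵥ n) := by
        rw [← Matrix.dotProduct_mulVec, Matrix.mulVec_mulVec, Matrix.mulVec_mulVec,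
          Matrix.mul_assoc]
      _ = _ := by rw [(pinv_isMoorePenrose S).mul_mul_right]
  have hexp : ∀ y, (g y - ∑ i, a i * f i y) ^ 2 =
      g y ^ 2 - 2 * ∑ i, a i * (f i y * g y) + ∑ i, ∑ j, a i * a j * (f i y * f j y) := by
    intro y
    have h1 : ∑ i, ∑ j, a i * a j * (f i y * f j y) = (∑ i, a i * f i y) ^ 2 := by
      rw [sq, Finset.sum_mul_sum]
      exact Finset.sum_congr rfl fun i _ => Finset.sum_congr rfl fun j _ => by ring
    have h2 : ∑ i, a i * (f i y * g y) = (∑ i, a i * f i y) * g y := by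
      rw [Finset.sum_mul]
      exact Finset.sum_congr rfl fun i _ => by ring
    rw [h1, h2]
    ring
  have hi1 : Integrable (fun y => 2 * ∑ i, a i * (f i y * g y)) P :=
    (integrable_finsetSum _ fun i _ => (hfg i).const_mul (a i)).const_mul 2
  have hgi : Integrable (fun y => g y ^ 2 - 2 * ∑ i, a i * (f i y * g y)) P := hgg.sub hi1
  have hi2 : Integrable (fun y => ∑ i, ∑ j, a i * a j * (f i y * f j y)) P :=
    integrable_finsetSum _ fun i _ => integrable_finsetSum _ fun j _ => (hff i j).const_mul _
  have hint : ∫ y, (g y - ∑ i, a i * f i y) ^ 2 ∂P =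
      ∫ y, g y ^ 2 ∂P - 2 * (n ⬝ᵥ a) + a ⬝ᵥ (S *ᵥ a) := by
    simp only [hexp]
    rw [integral_add hgi hi2, integral_sub hgg hi1, integral_const_mul,
      integral_finsetSum _ fun i _ => (hfg i).const_mul (a i),
      integral_finsetSum _ fun i _ => integrable_finsetSum _ fun j _ => (hff i j).const_mul _]
    congr 1
    · congr 2
      refine Finset.sum_congr rfl fun i _ => ?_
      rw [integral_const_mul, hn i, mul_comm]
    · refine Finset.sum_congr rfl fun i _ => ?_
      rw [integral_finsetSum _ fun j _ => (hff i j).const_mul _, Matrix.mulVec, dotProduct,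
        Finset.mul_sum]
      refine Finset.sum_congr rfl fun j _ => ?_
      rw [integral_const_mul, hS i j]
      ring
  have h0 : 0 ≤ ∫ y, (g y - ∑ i, a i * f i y) ^ 2 ∂P := integral_nonneg fun _ => sq_nonneg _
  rw [hint, haSa] at h0
  linarith

/-! ### Expectations in the exponential family as exponential integrals -/

namespace CanonicalExpFamily

variable {M N : ℕ} (F : CanonicalExpFamily M N) {x : EuclideanSpace ℝ (Fin N)}

theorem measurable_exp_mul (x : EuclideanSpace ℝ (Fin N)) :
    Measurable fun y => Real.exp (inner ℝ (F.φ y) x) * F.h y :=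
  (F.measurable_φ.inner measurable_const).exp.mul F.measurable_h

theorem exp_mul_nonneg (x : EuclideanSpace ℝ (Fin N)) (y : EuclideanSpace ℝ (Fin M)) :
    0 ≤ Real.exp (inner ℝ (F.φ y) x) * F.h y :=
  mul_nonneg (Real.exp_pos _).le (F.h_nonneg y)

variable {F} in
theorem integrable_exp_mul (hx : x ∈ F.naturalSpace) :
    Integrable fun y => Real.exp (inner ℝ (F.φ y) x) * F.h y :=
  ⟨(F.measurable_exp_mul x).aestronglyMeasurable,
    (hasFiniteIntegral_iff_ofReal (Filter.Eventually.of_forall (F.exp_mul_nonneg x))).mpr hx⟩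

variable {F} in
theorem mgf_pos (hx : x ∈ F.naturalSpace) : 0 < F.mgf x := by
  refine (integral_nonneg (F.exp_mul_nonneg x)).lt_of_ne' fun h0 => F.h_ne_zero ?_
  filter_upwards [(integral_eq_zero_iff_of_nonneg (F.exp_mul_nonneg x)
    (integrable_exp_mul hx)).mp h0] with y hy
  simpa [Real.exp_ne_zero] using hy

theorem mgf_eq_expIntegral : F.mgf = expIntegral volume F.φ F.h := by
  ext x
  simp only [mgf, expIntegral, mul_comm]

theorem density_nonneg (x : EuclideanSpace ℝ (Fin N)) (y : EuclideanSpace ℝ (Fin M)) :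
    0 ≤ F.density x y :=
  mul_nonneg (Real.exp_pos _).le (F.h_nonneg y)

theorem measurable_density (x : EuclideanSpace ℝ (Fin N)) : Measurable (F.density x) :=
  ((F.measurable_φ.inner measurable_const).sub_const _).exp.mul F.measurable_h

variable {F} in
theorem density_eq (hx : x ∈ F.naturalSpace) (y : EuclideanSpace ℝ (Fin M)) :
    F.density x y = (F.mgf x)⁻¹ * (Real.exp (inner ℝ (F.φ y) x) * F.h y) := by
  rw [density, cumulant, Real.exp_sub, Real.exp_log (mgf_pos hx)]
  ring

variable {F} in
theorem integrable_law_iff (hx : x ∈ F.naturalSpace) {f : EuclideanSpace ℝ (Fin M) → ℝ} :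
    Integrable f (F.law x) ↔
      Integrable fun y => f y * F.h y * Real.exp (inner ℝ (F.φ y) x) := by
  rw [law, integrable_withDensity_iff (F.measurable_density x).ennreal_ofReal
    (Filter.Eventually.of_forall fun _ => ENNReal.ofReal_lt_top),
    ← integrable_const_mul_iff (isUnit_iff_ne_zero.mpr (inv_ne_zero (mgf_pos hx).ne'))
      fun y => f y * F.h y * Real.exp (inner ℝ (F.φ y) x)]
  refine integrable_congr (Filter.Eventually.of_forall fun y => ?_)
  simp only
  rw [ENNReal.toReal_ofReal (F.density_nonneg x y), density_eq hx]
  ring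

variable {F} in
theorem integral_law (hx : x ∈ F.naturalSpace) (f : EuclideanSpace ℝ (Fin M) → ℝ) :
    ∫ y, f y ∂(F.law x) = (F.mgf x)⁻¹ * expIntegral volume F.φ (fun y => f y * F.h y) x := by
  rw [law, integral_withDensity_eq_integral_toReal_smul (F.measurable_density x).ennreal_ofReal
    (Filter.Eventually.of_forall fun _ => ENNReal.ofReal_lt_top), expIntegral,
    ← integral_const_mul]
  refine integral_congr_ae (Filter.Eventually.of_forall fun y => ?_)
  simp only
  rw [ENNReal.toReal_ofReal (F.density_nonneg x y), density_eq hx, smul_eq_mul]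
  ring

variable {F} in
theorem isProbabilityMeasure_law (hx : x ∈ F.naturalSpace) : IsProbabilityMeasure (F.law x) := by
  have h : F.density x = fun y => (F.mgf x)⁻¹ * (Real.exp (inner ℝ (F.φ y) x) * F.h y) :=
    funext (density_eq hx)
  have hint : Integrable (F.density x) := by
    rw [h]
    exact (integrable_exp_mul hx).const_mul _
  constructor
  rw [law, withDensity_apply _ .univ, Measure.restrict_univ,
    ← ofReal_integral_eq_lintegral_ofReal hint (Filter.Eventually.of_forall (F.density_nonneg x)),
    h, integral_const_mul, ← mgf, inv_mul_cancel₀ (mgf_pos hx).ne', ENNReal.ofReal_one]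

theorem expIntegrableOn_h {U : Set (EuclideanSpace ℝ (Fin N))} (hU : U ⊆ F.naturalSpace) :
    ExpIntegrableOn volume F.φ F.h U where
  measurable := F.measurable_h
  integrable u hu := by simpa only [mul_comm] using integrable_exp_mul (hU hu)

variable {F} in
/-- If `g` is square integrable at `x₀`, then it is integrable at `x` provided that
`x + x - x₀` is a natural parameter. -/
theorem integrable_mul_exp_of_memLp_two {x₀ : EuclideanSpace ℝ (Fin N)}
    {g : EuclideanSpace ℝ (Fin M) → ℝ}
    (hg : Measurable g) (hx₀ : x₀ ∈ F.naturalSpace) (hL2 : MemLp g 2 (F.law x₀))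
    (hx : x + x - x₀ ∈ F.naturalSpace) :
    Integrable fun y => g y * F.h y * Real.exp (inner ℝ (F.φ y) x) := by
  refine (((integrable_law_iff hx₀).mp hL2.integrable_sq).add (integrable_exp_mul hx)).mono'
    ((hg.mul F.measurable_h).mul
      (F.measurable_φ.inner measurable_const).exp).aestronglyMeasurable
    (Filter.Eventually.of_forall fun y => ?_)
  set a := Real.exp (inner ℝ (F.φ y) (x - x₀)) with ha
  have h1 : Real.exp (inner ℝ (F.φ y) x) = a * Real.exp (inner ℝ (F.φ y) x₀) := by
    rw [ha, ← Real.exp_add, ← inner_add_right, sub_add_cancel]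
  have h2 : Real.exp (inner ℝ (F.φ y) (x + x - x₀)) =
      a ^ 2 * Real.exp (inner ℝ (F.φ y) x₀) := by
    rw [sq, ha, ← Real.exp_add, ← Real.exp_add, ← inner_add_right, ← inner_add_right]
    congr 2
    abel
  have h3 : |g y| * a ≤ g y ^ 2 + a ^ 2 := by
    nlinarith [sq_nonneg (|g y| - a), sq_abs (g y), abs_nonneg (g y), sq_nonneg (|g y|),
      sq_nonneg a]
  simp only [Pi.add_apply, norm_mul, Real.norm_eq_abs, Real.abs_exp, abs_of_nonneg (F.h_nonneg y)]
  rw [h1, h2]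
  calc _ = (|g y| * a) * (F.h y * Real.exp (inner ℝ (F.φ y) x₀)) := by ring
    _ ≤ (g y ^ 2 + a ^ 2) * (F.h y * Real.exp (inner ℝ (F.φ y) x₀)) :=
      mul_le_mul_of_nonneg_right h3 (mul_nonneg (F.h_nonneg y) (Real.exp_pos _).le)
    _ = _ := by ring

theorem monomial_add (p q : Fin N → ℕ) (y : EuclideanSpace ℝ (Fin M)) :
    F.monomial (p + q) y = F.monomial p y * F.monomial q y := by
  simp only [monomial, Pi.add_apply, pow_add, Finset.prod_mul_distrib]

end CanonicalExpFamily

/-! ### The variance bound -/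

theorem theorem7 {M N L : ℕ} (F : CanonicalExpFamily M N)
    (X : Set (EuclideanSpace ℝ (Fin N))) (hX : X ⊆ F.naturalSpace)
    (x₀ : EuclideanSpace ℝ (Fin N)) (hx₀ : x₀ ∈ interior X)
    (hsum : ∀ x₁ ∈ X, ∀ x₂ ∈ X, x₁ + x₂ - x₀ ∈ F.naturalSpace)
    (p : Fin L → Fin N → ℕ)
    (g : EuclideanSpace ℝ (Fin M) → ℝ) (hg : Measurable g)
    (hvar : evariance g (F.law x₀) < ⊤)
    (γ : EuclideanSpace ℝ (Fin N) → ℝ) (hγ : ∀ x ∈ X, γ x = ∫ y, g y ∂(F.law x)) :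
    (∀ x ∈ X, Integrable g (F.law x)) ∧
    (∀ q : Fin N → ℕ, Integrable (F.monomial q) (F.law x₀)) ∧
    ContDiffOn ℝ ∞ γ (interior X) ∧
    F.derivVector p γ x₀ ⬝ᵥ (pinv (F.momentMatrix p x₀) *ᵥ F.derivVector p γ x₀) - γ x₀ ^ 2
      ≤ variance g (F.law x₀) := by
  have hU : IsOpen (interior X) := isOpen_interior
  have hx₀X : x₀ ∈ X := interior_subset hx₀
  have hx₀N : x₀ ∈ F.naturalSpace := hX hx₀X
  have := CanonicalExpFamily.isProbabilityMeasure_law hx₀N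
  have hL2 : MemLp g 2 (F.law x₀) := (evariance_lt_top_iff_memLp hg.aestronglyMeasurable).mp hvar
  have hgX : ∀ x ∈ X, Integrable fun y => g y * F.h y * Real.exp (inner ℝ (F.φ y) x) :=
    fun x hx => CanonicalExpFamily.integrable_mul_exp_of_memLp_two hg hx₀N hL2 (hsum x hx x hx)
  have hgU : ExpIntegrableOn volume F.φ (fun y => g y * F.h y) (interior X) :=
    ⟨hg.mul F.measurable_h, fun x hx => hgX x (interior_subset hx)⟩
  have hhU : ExpIntegrableOn volume F.φ F.h (interior X) :=
    F.expIntegrableOn_h (interior_subset.trans hX)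
  have hmgf : ContDiffOn ℝ ∞ F.mgf (interior X) := by
    rw [F.mgf_eq_expIntegral]
    exact hhU.contDiffOn F.measurable_φ hU
  have hpos : ∀ x ∈ interior X, F.mgf x ≠ 0 := fun x hx =>
    (CanonicalExpFamily.mgf_pos (hX (interior_subset hx))).ne'
  have hγU : Set.EqOn γ (fun x => (F.mgf x)⁻¹ *
      expIntegral volume F.φ (fun y => g y * F.h y) x) (interior X) := fun x hx => by
    rw [hγ x (interior_subset hx),
      CanonicalExpFamily.integral_law (hX (interior_subset hx))]
  have hγs : ContDiffOn ℝ ∞ γ (interior X) :=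
    ((hmgf.inv hpos).mul (hgU.contDiffOn F.measurable_φ hU)).congr hγU
  have hmono : ∀ q, Integrable (F.monomial q) (F.law x₀) := fun q =>
    (CanonicalExpFamily.integrable_law_iff hx₀N).mpr
      ((hhU.multiDeriv F.measurable_φ hU q).1.integrable x₀ hx₀)
  have hmonog : ∀ q, Integrable (fun y => F.monomial q y * g y) (F.law x₀) := fun q => by
    rw [CanonicalExpFamily.integrable_law_iff hx₀N]
    simpa only [mul_assoc, CanonicalExpFamily.monomial] using
      (hgU.multiDeriv F.measurable_φ hU q).1.integrable x₀ hx₀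
  refine ⟨fun x hx => (CanonicalExpFamily.integrable_law_iff (hX hx)).mpr (hgX x hx), hmono, hγs,
    ?_⟩
  have hmoment : ∀ q, multiDeriv q F.mgf x₀ = F.mgf x₀ * F.moment x₀ q := fun q => by
    rw [CanonicalExpFamily.moment, CanonicalExpFamily.integral_law hx₀N,
      mul_inv_cancel_left₀ (hpos x₀ hx₀), F.mgf_eq_expIntegral,
      (hhU.multiDeriv F.measurable_φ hU q).2 hx₀]
    rfl
  have hn : ∀ l, F.derivVector p γ x₀ l = ∫ y, F.monomial (p l) y * g y ∂(F.law x₀) := fun l => by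
    apply mul_left_cancel₀ (hpos x₀ hx₀)
    rw [CanonicalExpFamily.integral_law hx₀N, mul_inv_cancel_left₀ (hpos x₀ hx₀)]
    -- An identity on an open neighbourhood of x₀, so both sides may be differentiated there.
    have h1 : Set.EqOn (fun x => γ x * F.mgf x)
        (expIntegral volume F.φ (fun y => g y * F.h y)) (interior X) := fun x hx => by
      simp only
      rw [hγU hx, mul_comm, mul_inv_cancel_left₀ (hpos x hx)]
    have h2 := multiDeriv_congr hU h1 (p l) hx₀
    rw [multiDeriv_mul hU hγs hmgf (p l) hx₀,
      (hgU.multiDeriv F.measurable_φ hU (p l)).2 hx₀] at h2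
    simp only [mul_assoc]
    refine Eq.trans ?_ h2
    rw [CanonicalExpFamily.derivVector, Finset.mul_sum]
    refine Finset.sum_congr rfl fun q _ => ?_
    rw [hmoment]
    ring
  have hbessel := dotProduct_pinv_gram_mulVec_le (P := F.law x₀) (g := g)
    (f := fun l => F.monomial (p l)) hL2.integrable_sq (fun l => hmonog (p l))
    (fun l l' => by
      simpa only [← F.monomial_add] using hmono (p l + p l')) hn
    (S := F.momentMatrix p x₀) (fun l l' => by
      simp only [CanonicalExpFamily.momentMatrix, Matrix.of_apply, CanonicalExpFamily.moment,
        F.monomial_add])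
  rw [variance_eq_sub hL2, hγ x₀ hx₀X]
  exact sub_le_sub_right hbessel _
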